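/- Let $\Bbbk$ be an algebraically closed field of characteristic $0$, $\Gamma$ a noetherian commutative $\Bbbk$-algebra which is a domain, $K$ its field of fractions, $L/K$ a finite Galois extension with group $G$, and $\bar\Gamma$ the integral closure of $\Gamma$ in $L$. Let $\mathcal M$ be a submonoid of the group $\operatorname{Aut}_{\Bbbk} L$ that is closed under conjugation by $G$ and separating with respect to $K$, i.e. if $m_1,m_2\in\mathcal M$ and $m_1|_K=m_2|_K$ then $m_1=m_2$. Let $L*\mathcal M$ be the skew monoid ring, with multiplication $(am)(bm')=(a\,m(b))(mm')$ for $a,b\in L$, $m,m'\in\mathcal M$, on which $g\in G$ acts by $am\mapsto g(a)\,(gmg^{-1})$, and let $\mathcal K=(L*\mathcal M)^G$ be the ring of invariants. A Galois ring over $\Gamma$ is a subring $U\subset\mathcal K$ generated by $\Gamma$ and finitely many elements, with $KU=UK=\mathcal K$. It is a Galois order if for every finite dimensional right (respectively left) $K$-subspace $W\subset\mathcal K$ the right (respectively left) $\Gamma$-module $W\cap U$ is finitely generated. For maximal ideals $\mathfrak m,\mathfrak n$ of $\Gamma$ put $$\mathcal A(\mathfrak m,\mathfrak n)=\varinjlim_{V}\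 \varprojlim_{a,b}\ V/(\mathfrak n^{a}V+V\mathfrak m^{b}),$$ where $V$ runs over the finitely generated $\Gamma$-subbimodules of $U$; the image of $u\in U$ in $\mathcal A(\mathfrak m,\mathfrak n)$ is the class of $u\in\Gamma u\Gamma$. Choose maximal ideals $\ell_{\mathfrak m},\ell_{\mathfrak n}$ of $\bar\Gamma$ lying over $\mathfrak m$ and $\mathfrak n$, let $\mathcal M_{\mathfrak m}=\{\sigma\in\mathcal M:\sigma(\ell_{\mathfrak m})=\ell_{\mathfrak m}\}$ and $\mathcal M_{\mathfrak n}=\{\sigma\in\mathcal M:\sigma(\ell_{\mathfrak n})=\ell_{\mathfrak n}\}$, and let $$S=S(\mathfrak m,\mathfrak n)=\{\sigma\in\mathcal M:\ g_2(\ell_{\mathfrak n})=\sigma g_1(\ell_{\mathfrak m})\text{ for some }g_1,g_2\in G\},\qquad U(S)=\{u\in U:\operatorname{supp}u\subset S\},$$ where $\operatorname{supp}u\subset\mathcal M$ is the set of those $m$ whose coefficient in $u$ is nonzero, and the translates of $\ell_{\mathfrak m}$ and $\ell_{\mathfrak n}$ are compared as subsets of $L$. **Theorem.** Let $U$ be a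 Galois order over $\Gamma$, and let $\mathfrak m,\mathfrak n$ be maximal ideals of $\Gamma$ such that $S(\mathfrak m,\mathfrak n)$ is finite and nonempty and $\mathcal M_{\mathfrak m}$, $\mathcal M_{\mathfrak n}$ are finite. Then the image of $U(S)$ in $\mathcal A(\mathfrak m,\mathfrak n)$ is nonzero. -/

import Mathlib

noncomputable section

namespace GaloisOrder

/-! ### Finitely generated modules inside a ring, over a possibly noncentral subalgebra -/

section Generated

variable {k A : Type*} [Field k] [Ring A] [Algebra k A]

/-- `W` is a finitely generated left `R`-submodule of `A`. -/
def IsFGLeft (R : Subalgebra k A) (W : Submodule k A) : Prop :=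
  ∃ T : Finset A, W = Subalgebra.toSubmodule R * Submodule.span k (T : Set A)

/-- `W` is a finitely generated right `R`-submodule of `A`. -/
def IsFGRight (R : Subalgebra k A) (W : Submodule k A) : Prop :=
  ∃ T : Finset A, W = Submodule.span k (T : Set A) * Subalgebra.toSubmodule R

/-- The `R`-subbimodule `R T R` of `A` generated by a set `T`. -/
def bimoduleSpan (R : Subalgebra k A) (T : Set A) : Submodule k A :=
  Subalgebra.toSubmodule R * Submodule.span k T * Subalgebra.toSubmodule R

/-- `W` is a finitely generated `R`-subbimodule of `A`. -/
def IsFGBimodule (R : Subalgebra k A) (W : Submodule k A) : Prop :=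
  ∃ T : Finset A, W = bimoduleSpan R (T : Set A)

theorem subset_bimoduleSpan (R : Subalgebra k A) (T : Set A) :
    T ⊆ (bimoduleSpan R T : Set A) := by
  intro t ht
  have h := Submodule.mul_mem_mul (Submodule.mul_mem_mul (show (1 : A) ∈ Subalgebra.toSubmodule R
    from R.one_mem) (Submodule.subset_span (R := k) ht))
    (show (1 : A) ∈ Subalgebra.toSubmodule R from R.one_mem)
  simpa [bimoduleSpan] using h

theorem bimoduleSpan_mono (R : Subalgebra k A) {T T' : Set A} (h : T ⊆ T') :
    bimoduleSpan R T ≤ bimoduleSpan R T' :=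
  mul_le_mul' (mul_le_mul' le_rfl (Submodule.span_mono h)) le_rfl

end Generated

/-! ### The category of a pair `Γ ⊆ U`

For a commutative algebra `Γ` and a ring `U` with a (not necessarily central) map `i : Γ → U`, the
objects of the category are the maximal ideals of `Γ`, and the morphisms from `m` to `n` are the
elements of `colim_V lim_{a,b} V / (n ^ a V + V m ^ b)`, where `V` runs over the finitely generated
`Γ`-subbimodules of `U`. -/

section Category

variable {k Γ U : Type*} [Field k] [CommRing Γ] [Algebra k Γ] [Ring U] [Algebra k U]
variable (i : Γ →ₐ[k] U)

/-- The image in `U` of an ideal of `Γ`. -/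
def idealImage (I : Ideal Γ) : Submodule k U :=
  (I.restrictScalars k).map i.toLinearMap

theorem idealImage_mono {I J : Ideal Γ} (h : I ≤ J) : idealImage i I ≤ idealImage i J :=
  Submodule.map_mono (fun _ hx => h hx)

/-- The set of finitely generated `Γ`-subbimodules of `U`, ordered by inclusion. -/
abbrev FGBimodule : Type _ := {V : Submodule k U // IsFGBimodule i.range V}

/-- `n ^ a V + V m ^ b`, as a subspace of `V`. -/
def level (m n : Ideal Γ) (V : Submodule k U) (p : ℕ × ℕ) : Submodule k V :=
  (idealImage i (n ^ p.1) * V ⊔ V * idealImage i (m ^ p.2)).submoduleOf V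

theorem level_anti (m n : Ideal Γ) (V : Submodule k U) {p q : ℕ × ℕ} (h : p ≤ q) :
    level i m n V q ≤ level i m n V p :=
  Submodule.comap_mono (sup_le_sup
    (mul_le_mul' (idealImage_mono i (Ideal.pow_le_pow_right h.1)) le_rfl)
    (mul_le_mul' le_rfl (idealImage_mono i (Ideal.pow_le_pow_right h.2))))

theorem level_le_comap (m n : Ideal Γ) {V W : Submodule k U} (h : V ≤ W) (p : ℕ × ℕ) :
    level i m n V p ≤ (level i m n W p).comap (Submodule.inclusion h) := fun _ hx =>
  (sup_le_sup (mul_le_mul' le_rfl h) (mul_le_mul' h le_rfl) :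
    idealImage i (n ^ p.1) * V ⊔ V * idealImage i (m ^ p.2) ≤
      idealImage i (n ^ p.1) * W ⊔ W * idealImage i (m ^ p.2)) hx

/-- The completion `lim_{a,b} V / (n ^ a V + V m ^ b)`: compatible families of classes. -/
def completion (m n : Ideal Γ) (V : Submodule k U) :
    Submodule k (∀ p : ℕ × ℕ, V ⧸ level i m n V p) where
  carrier := {x | ∀ (p q : ℕ × ℕ) (h : p ≤ q), Submodule.factor (level_anti i m n V h) (x q) = x p}
  add_mem' hx hy p q h := by simp [hx p q h, hy p q h]
  zero_mem' p q h := by simp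
  smul_mem' c x hx p q h := by simp [hx p q h]

/-- The canonical map from `V` to its completion. -/
def toCompletion (m n : Ideal Γ) (V : Submodule k U) : V →ₗ[k] completion i m n V :=
  (LinearMap.pi fun p => (level i m n V p).mkQ).codRestrict (completion i m n V)
    (fun _ _ _ _ => rfl)

/-- The map of completions induced by an inclusion `V ≤ W`. -/
def completionMap (m n : Ideal Γ) {V W : Submodule k U} (h : V ≤ W) :
    completion i m n V →ₗ[k] completion i m n W :=
  ((LinearMap.pi fun p => (Submodule.mapQ (level i m n V p) (level i m n W p)
      (Submodule.inclusion h) (level_le_comap i m n h p)).comp (LinearMap.proj p)).comp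
    (completion i m n V).subtype).codRestrict (completion i m n W) (by
      rintro ⟨x, hx⟩ p q hpq
      have hxp := hx p q hpq
      obtain ⟨v, hv⟩ := Submodule.mkQ_surjective _ (x q)
      simp only [LinearMap.comp_apply, LinearMap.pi_apply, LinearMap.proj_apply,
        Submodule.subtype_apply]
      rw [← hxp, ← hv]
      rfl)

theorem completionMap_toCompletion (m n : Ideal Γ) {V W : Submodule k U} (h : V ≤ W) (v : V) :
    completionMap i m n h (toCompletion i m n V v) =
      toCompletion i m n W (Submodule.inclusion h v) := rfl

open Classical in
/-- The space of morphisms from `m` to `n`. -/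
abbrev Hom (m n : Ideal Γ) : Type _ :=
  Module.DirectLimit (R := k) (ι := FGBimodule i) (fun V => completion i m n V.1)
    (fun _ _ h => completionMap i m n h)

/-- The finitely generated subbimodule `Γ u Γ`. -/
def principal (u : U) : FGBimodule i := ⟨bimoduleSpan i.range {u}, {u}, by simp⟩

theorem mem_principal (u : U) : u ∈ (principal i u).1 := subset_bimoduleSpan _ _ rfl

instance : IsDirectedOrder (FGBimodule i) where
  directed := by
    classical
    rintro ⟨_, T, rfl⟩ ⟨_, T', rfl⟩
    exact ⟨⟨_, T ∪ T', rfl⟩, bimoduleSpan_mono _ (by simp), bimoduleSpan_mono _ (by simp)⟩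

open Classical in
/-- The class in `Hom m n` of an element `u` of a finitely generated subbimodule `V`. -/
def classOf (m n : Ideal Γ) (V : FGBimodule i) : V.1 →ₗ[k] Hom i m n :=
  (Module.DirectLimit.of k (FGBimodule i) (fun V => completion i m n V.1)
    (fun _ _ h => completionMap i m n h) V).comp (toCompletion i m n V.1)

theorem classOf_inclusion (m n : Ideal Γ) {V W : FGBimodule i} (h : V ≤ W) (v : V.1) :
    classOf i m n W (Submodule.inclusion h v) = classOf i m n V v := by
  classical
  exact Module.DirectLimit.of_f (f := fun (V W : FGBimodule i) (h : V ≤ W) =>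
    completionMap i m n h) (hij := h) (x := toCompletion i m n V.1 v)

theorem classOf_eq (m n : Ideal Γ) (V W : FGBimodule i) {u : U} (hV : u ∈ V.1) (hW : u ∈ W.1) :
    classOf i m n V ⟨u, hV⟩ = classOf i m n W ⟨u, hW⟩ := by
  obtain ⟨X, hX, hX'⟩ := exists_ge_ge V W
  rw [← classOf_inclusion i m n hX, ← classOf_inclusion i m n hX']
  rfl

/-- The canonical map `U → Hom m n`, sending `u` to the class of `u ∈ Γ u Γ`. -/
def toHom (m n : Ideal Γ) : U →ₗ[k] Hom i m n where
  toFun u := classOf i m n (principal i u) ⟨u, mem_principal i u⟩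
  map_add' u v := by
    obtain ⟨X, hX, hX'⟩ := exists_ge_ge (principal i u) (principal i v)
    have hu : u ∈ X.1 := hX (mem_principal i u)
    have hv : v ∈ X.1 := hX' (mem_principal i v)
    rw [classOf_eq i m n _ X _ (X.1.add_mem hu hv), classOf_eq i m n _ X _ hu,
      classOf_eq i m n _ X _ hv, ← map_add]
    rfl
  map_smul' c u := by
    have hu := mem_principal i u
    rw [classOf_eq i m n _ (principal i u) _ (Submodule.smul_mem _ c hu), RingHom.id_apply,
      ← map_smul]
    rfl

end Category

/-! ### Skew monoid rings and their invariants -/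

section Skew

variable {k K L : Type*} [Field k] [Field K] [Field L] [Algebra k K] [Algebra K L] [Algebra k L]
  [IsScalarTower k K L]

/-- An element of the Galois group of `L / K`, as an automorphism of the `k`-algebra `L`. -/
def galAut (k : Type*) {K L : Type*} [Field k] [Field K] [Field L] [Algebra k K] [Algebra K L]
    [Algebra k L] [IsScalarTower k K L] : (L ≃ₐ[K] L) →* (L ≃ₐ[k] L) where
  toFun g := g.restrictScalars k
  map_one' := rfl
  map_mul' _ _ := rfl

/-- `M` is closed under conjugation by the Galois group of `L / K`. -/
def IsConjStable (K : Type*) [Field K] [Algebra k K] [Algebra K L] [IsScalarTower k K L]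
    (M : Submonoid (L ≃ₐ[k] L)) : Prop :=
  ∀ (g : L ≃ₐ[K] L), ∀ m ∈ M, galAut k g * m * (galAut k g)⁻¹ ∈ M

/-- `M` is separating with respect to `K`: its elements are determined by their restrictions
to `K`. -/
def IsSeparating (K : Type*) [Field K] [Algebra K L] (M : Submonoid (L ≃ₐ[k] L)) : Prop :=
  ∀ m₁ ∈ M, ∀ m₂ ∈ M, (∀ x : K, m₁ (algebraMap K L x) = m₂ (algebraMap K L x)) → m₁ = m₂

/-- The skew monoid ring `L * M`, with `(a m) (b m') = (a m(b)) (m m')`. -/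
abbrev Skew (M : Submonoid (L ≃ₐ[k] L)) : Type _ := SkewMonoidAlgebra L M

/-- The embedding `a ↦ a • 1` of `L` into `L * M`. -/
def coeffHom (M : Submonoid (L ≃ₐ[k] L)) : L →ₐ[k] Skew M where
  toFun a := SkewMonoidAlgebra.single 1 a
  map_one' := rfl
  map_zero' := SkewMonoidAlgebra.single_zero 1
  map_add' := SkewMonoidAlgebra.single_add 1
  map_mul' a b := by simp [SkewMonoidAlgebra.single_mul_single]
  commutes' _ := rfl

theorem coeffHom_apply (M : Submonoid (L ≃ₐ[k] L)) (a : L) :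
    coeffHom M a = SkewMonoidAlgebra.single 1 a := rfl

variable {M : Submonoid (L ≃ₐ[k] L)}

/-- Conjugation `m ↦ g m g⁻¹` on `M`. -/
def conjHom (hM : IsConjStable K M) (g : L ≃ₐ[K] L) : M →* M where
  toFun m := ⟨galAut k g * m * (galAut k g)⁻¹, hM g m m.2⟩
  map_one' := by ext; simp
  map_mul' m m' := by ext; simp

/-- The action of `g` in the Galois group on `L * M`: `a m ↦ g(a) (g m g⁻¹)`. -/
def galAct (hM : IsConjStable K M) (g : L ≃ₐ[K] L) : Skew M →ₐ[k] Skew M :=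
  SkewMonoidAlgebra.liftNCAlgHom ((coeffHom M).comp (galAut k g : L →ₐ[k] L))
    ((SkewMonoidAlgebra.of L M).comp (conjHom hM g)) (by
      intro a m
      simp [coeffHom_apply, SkewMonoidAlgebra.single_mul_single, conjHom, Submonoid.smul_def])

theorem galAct_single (hM : IsConjStable K M) (g : L ≃ₐ[K] L) (m : M) (a : L) :
    galAct hM g (SkewMonoidAlgebra.single m a) =
      SkewMonoidAlgebra.single (conjHom hM g m) (g a) := by
  have h : galAct hM g (SkewMonoidAlgebra.single m a) =
      coeffHom M (g a) * SkewMonoidAlgebra.of L M (conjHom hM g m) :=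
    SkewMonoidAlgebra.liftNC_single _ _ _ _
  rw [h]
  simp [coeffHom_apply, SkewMonoidAlgebra.single_mul_single]

/-- The subring `(L * M) ^ G` of invariants of the Galois group. -/
def invariants (hM : IsConjStable K M) : Subalgebra k (Skew M) :=
  ⨅ g : L ≃ₐ[K] L, AlgHom.equalizer (galAct hM g) (AlgHom.id k (Skew M))

/-- The embedding into `L * M` of an algebra `R` that maps to `L`. -/
def baseHom (R : Type*) [CommRing R] [Algebra k R] [Algebra R L] [IsScalarTower k R L]
    (M : Submonoid (L ≃ₐ[k] L)) : R →ₐ[k] Skew M :=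
  (coeffHom M).comp (IsScalarTower.toAlgHom k R L)

variable {Γ : Type*} [CommRing Γ] [Algebra k Γ] [Algebra Γ L] [IsScalarTower k Γ L]

/-- `U` is a Galois ring over `Γ`: a subring of `(L * M) ^ G` that is generated over `Γ` by finitely
many elements and satisfies `K U = U K = (L * M) ^ G`. -/
structure IsGaloisRing (Γ : Type*) [CommRing Γ] [Algebra k Γ] [Algebra Γ L] [IsScalarTower k Γ L]
    (hM : IsConjStable K M) (U : Subalgebra k (Skew M)) : Prop where
  le_invariants : U ≤ invariants hM
  finitelyGenerated : ∃ T : Finset (Skew M), U = (baseHom Γ M).range ⊔ Algebra.adjoin k (T : Set _)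
  left_span : Subalgebra.toSubmodule (baseHom K M).range * Subalgebra.toSubmodule U =
    Subalgebra.toSubmodule (invariants hM)
  right_span : Subalgebra.toSubmodule U * Subalgebra.toSubmodule (baseHom K M).range =
    Subalgebra.toSubmodule (invariants hM)

/-- `U` is a Galois order over `Γ`: a Galois ring such that `W ∩ U` is a finitely generated right
(left) `Γ`-module for each finite dimensional right (left) `K`-subspace `W` of `(L * M) ^ G`. -/
structure IsGaloisOrder (Γ : Type*) [CommRing Γ] [Algebra k Γ] [Algebra Γ L] [IsScalarTower k Γ L]
    (hM : IsConjStable K M) (U : Subalgebra k (Skew M)) : Prop extends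
    IsGaloisRing Γ hM U where
  right_order : ∀ W ≤ Subalgebra.toSubmodule (invariants hM), IsFGRight (baseHom K M).range W →
    IsFGRight (baseHom Γ M).range (W ⊓ Subalgebra.toSubmodule U)
  left_order : ∀ W ≤ Subalgebra.toSubmodule (invariants hM), IsFGLeft (baseHom K M).range W →
    IsFGLeft (baseHom Γ M).range (W ⊓ Subalgebra.toSubmodule U)

theorem IsGaloisRing.base_le {hM : IsConjStable K M} {U : Subalgebra k (Skew M)}
    (hU : IsGaloisRing Γ hM U) (γ : Γ) : baseHom Γ M γ ∈ U := by
  obtain ⟨T, hT⟩ := hU.finitelyGenerated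
  rw [hT]
  exact (le_sup_left : (baseHom Γ M).range ≤ _) ⟨γ, rfl⟩

/-- The embedding of `Γ` into a Galois ring `U` over `Γ`. -/
def IsGaloisRing.incl {hM : IsConjStable K M} {U : Subalgebra k (Skew M)}
    (hU : IsGaloisRing Γ hM U) : Γ →ₐ[k] U :=
  (baseHom Γ M).codRestrict U hU.base_le

/-- `U(S)`: the elements of `U` with support in `S`. -/
def supportedIn (U : Subalgebra k (Skew M)) (S : Set M) : Submodule k U where
  carrier := {u | ∀ m, (u : Skew M).coeff m ≠ 0 → m ∈ S}
  add_mem' {u v} hu hv m h := by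
    by_contra hm
    have h1 : (u : Skew M).coeff m = 0 := not_not.1 fun h' => hm (hu m h')
    have h2 : (v : Skew M).coeff m = 0 := not_not.1 fun h' => hm (hv m h')
    exact h (by simp [h1, h2])
  zero_mem' m h := absurd (by simp) h
  smul_mem' c u hu m h := hu m fun h' => h (by simp [h'])

end Skew

/-! ### Maximal ideals of the integral closure -/

section Ideals

variable {k K Γ L : Type*} [Field k] [Field K] [Field L] [Algebra k K] [Algebra K L] [Algebra k L]
  [IsScalarTower k K L] [CommRing Γ] [Algebra Γ L]

/-- `l` is a maximal ideal of the integral closure of `Γ` in `L` lying over `m`. -/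
def LiesAbove (l : Ideal (integralClosure Γ L)) (m : Ideal Γ) : Prop :=
  l.IsMaximal ∧ l.comap (algebraMap Γ (integralClosure Γ L)) = m

/-- The image `σ(l)`, as a subset of `L`, of an ideal of the integral closure of `Γ` in `L`.
Working with subsets of `L` makes sense of `σ(l)` whether or not `σ` preserves the integral
closure. -/
def translate (σ : L ≃ₐ[k] L) (l : Ideal (integralClosure Γ L)) : Set L :=
  (fun x : integralClosure Γ L => σ (x : L)) '' (l : Set (integralClosure Γ L))

/-- The stabilizer of `l` in `M`. -/
def stabilizer (M : Submonoid (L ≃ₐ[k] L)) (l : Ideal (integralClosure Γ L)) : Set M :=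
  {σ | translate (σ : L ≃ₐ[k] L) l = translate (1 : L ≃ₐ[k] L) l}

/-- `S(m, n)`, in terms of ideals `lm` over `m` and `ln` over `n`: the elements `σ` of `M` with
`g₂ ln = σ g₁ lm` for some `g₁`, `g₂` in the Galois group of `L / K`. -/
def connecting (K : Type*) [Field K] [Algebra k K] [Algebra K L] [IsScalarTower k K L]
    (M : Submonoid (L ≃ₐ[k] L)) (lm ln : Ideal (integralClosure Γ L)) : Set M :=
  {σ | ∃ g₁ g₂ : L ≃ₐ[K] L,
    translate (galAut k g₂) ln = translate ((σ : L ≃ₐ[k] L) * galAut k g₁) lm}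

end Ideals

end GaloisOrder

end

/-!
Right and left multiplication by `Γ` on `L * M` become, on the coefficient at `σ`, multiplication by
`σ(Γ)` and by `Γ`. If `σ` occurs in the support of some element of the Galois order `U`, the
finiteness condition on `U` provides a finitely generated nonzero `Γ`-module `P ⊆ L` that is stable
under `σ(Γ)`, so that `Γ` and `σ(Γ)` both lie in the multiplier ring `B` of `P`, a finite
`Γ`-algebra. If `σ` lies in `S(m, n)`, an ideal `g(ln)` contains both `n` and `σ(m)` and cuts out a
proper ideal `q` of `B`. An element of `n ^ a V + V m ^ a` therefore has its coefficient at `σ` in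
`q ^ a N` for a fixed finitely generated `B`-module `N ⊆ L`, and Krull's intersection theorem shows
that this coefficient vanishes as soon as the class in `A(m, n)` does. So `U(S)` embeds in
`A(m, n)`. It is nonzero because `S` is stable under conjugation: the sum over the conjugates of
some `σ ∈ S` is an invariant, and a multiple of it by a nonzero element of `Γ` lies in `U`.
-/

namespace GaloisOrder

section CommutativeAlgebra

/-- The multiplier ring `{a | a P ⊆ P}` of a submodule `P` of a commutative algebra. For the
`Γ`-module of coefficients at `σ`, it contains both `Γ` and `σ(Γ)`. -/
def multiplierRing {R A : Type*} [CommRing R] [CommRing A] [Algebra R A] (P : Submodule R A) :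
    Subalgebra R A :=
  (P / P).toSubalgebra (fun x hx => by rwa [one_mul]) fun a b ha hb x hx => by
    rw [mul_assoc]
    exact ha _ (hb x hx)

theorem mem_multiplierRing {R A : Type*} [CommRing R] [CommRing A] [Algebra R A]
    {P : Submodule R A} {a : A} : a ∈ multiplierRing P ↔ ∀ x ∈ P, a * x ∈ P :=
  Submodule.mem_div_iff_forall_mul_mem

theorem isNoetherian_multiplierRing {R A : Type*} [CommRing R] [IsNoetherianRing R] [CommRing A]
    [IsDomain A] [Algebra R A] {P : Submodule R A} (hP : P.FG) (hP₀ : P ≠ ⊥) :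
    IsNoetherian R (multiplierRing P) := by
  obtain ⟨x, hx, hx₀⟩ := P.exists_mem_ne_zero_of_ne_bot hP₀
  have := isNoetherian_of_fg_of_noetherian P hP
  let mulRight : multiplierRing P →ₗ[R] P :=
    ((LinearMap.mulRight R x).comp (multiplierRing P).val.toLinearMap).codRestrict P
      fun b => mem_multiplierRing.1 b.2 x hx
  exact isNoetherian_of_injective mulRight fun a b hab =>
    Subtype.ext (mul_right_cancel₀ hx₀ (congrArg Subtype.val hab))

theorem iInf_pow_smul_eq_bot_of_fg {B E : Type*} [CommRing B] [IsDomain B] [IsNoetherianRing B]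
    [AddCommGroup E] [Module B E] [Module.IsTorsionFree B E] {q : Ideal B} (hq : q ≠ ⊤)
    {N : Submodule B E} (hN : N.FG) : ⨅ a : ℕ, q ^ a • N = ⊥ := by
  have : Module.Finite B N := Module.Finite.iff_fg.2 hN
  have smul_eq_map (a : ℕ) : q ^ a • N = (q ^ a • ⊤ : Submodule B N).map N.subtype := by
    rw [Submodule.map_smul'', Submodule.map_subtype_top]
  simp_rw [smul_eq_map]
  rw [← Submodule.map_iInf _ N.injective_subtype,
    Ideal.iInf_pow_smul_eq_bot_of_isTorsionFree q hq, Submodule.map_bot]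

end CommutativeAlgebra

section Hom

variable {k Γ U : Type*} [Field k] [CommRing Γ] [Algebra k Γ] [Ring U] [Algebra k U]
  {i : Γ →ₐ[k] U} {m n : Ideal Γ}

theorem completionMap_self (V : Submodule k U) (x : completion i m n V) :
    completionMap i m n le_rfl x = x :=
  Subtype.ext <| funext fun p => DFunLike.congr_fun (Submodule.mapQ_id (level i m n V p)) (x.1 p)

theorem completionMap_completionMap {V W X : Submodule k U} (hVW : V ≤ W) (hWX : W ≤ X)
    (x : completion i m n V) :
    completionMap i m n hWX (completionMap i m n hVW x) = completionMap i m n (hVW.trans hWX) x :=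
  Subtype.ext <| funext fun p => (DFunLike.congr_fun (Submodule.mapQ_comp (level i m n V p)
    (level i m n W p) (level i m n X p) (Submodule.inclusion hVW) (Submodule.inclusion hWX)
    (level_le_comap i m n hVW p) (level_le_comap i m n hWX p)) (x.1 p)).symm

theorem toCompletion_eq_zero_iff {V : Submodule k U} {v : V} :
    toCompletion i m n V v = 0 ↔ ∀ p, v ∈ level i m n V p := by
  simp only [← Submodule.Quotient.mk_eq_zero]
  exact Subtype.ext_iff.trans funext_iff

theorem toHom_eq_zero_iff {u : U} :
    toHom i m n u = 0 ↔ ∃ V : FGBimodule i, ∃ hu : u ∈ V.1, ∀ p, ⟨u, hu⟩ ∈ level i m n V.1 p := by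
  classical
  simp only [← toCompletion_eq_zero_iff]
  constructor
  · intro h
    have : DirectedSystem (fun V : FGBimodule i => completion i m n V.1)
        fun _ _ h => completionMap i m n h :=
      ⟨fun V => completionMap_self V.1, fun _ _ _ hVW hWX => completionMap_completionMap hVW hWX⟩
    obtain ⟨V, hV, hzero⟩ := Module.DirectLimit.of.zero_exact h
    exact ⟨V, hV (mem_principal i u), hzero⟩
  · rintro ⟨V, hu, hzero⟩
    calc toHom i m n u = classOf i m n V ⟨u, hu⟩ := classOf_eq i m n _ V _ hu
      _ = 0 := by rw [classOf, LinearMap.comp_apply, hzero, map_zero]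

end Hom

section BimoduleMap

variable {k Γ U B E : Type*} [Field k] [CommRing Γ] [Algebra k Γ] [Ring U] [Algebra k U]
  {i : Γ →ₐ[k] U} [CommRing B] [AddCommGroup E] [Module B E] {π : U →+ E} {l r : Γ →+* B}

theorem map_mem_span_of_mem_bimoduleSpan (hl : ∀ γ x, π (i γ * x) = l γ • π x)
    (hr : ∀ γ x, π (x * i γ) = r γ • π x) {T : Set U} {x : U}
    (hx : x ∈ bimoduleSpan i.range T) : π x ∈ Submodule.span B (π '' T) := by
  have hspan : ∀ y ∈ Submodule.span k T, π y ∈ Submodule.span B (π '' T) := by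
    intro y hy
    induction hy using Submodule.span_induction with
    | mem t ht => exact Submodule.subset_span ⟨t, ht, rfl⟩
    | zero => simp only [map_zero, zero_mem]
    | add y z _ _ hy hz => simpa only [map_add] using add_mem hy hz
    | smul c y _ hy =>
      rw [Algebra.smul_def, ← i.commutes, hl]
      exact Submodule.smul_mem _ _ hy
  have hleft : ∀ y ∈ Subalgebra.toSubmodule i.range * Submodule.span k T,
      π y ∈ Submodule.span B (π '' T) := by
    intro y hy
    induction hy using Submodule.mul_induction_on' with
    | mem_mul_mem z hz y hy =>
      obtain ⟨γ, rfl⟩ := hz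
      exact (hl γ y).symm ▸ Submodule.smul_mem _ _ (hspan y hy)
    | add y _ z _ hy hz => simpa only [map_add] using add_mem hy hz
  induction hx using Submodule.mul_induction_on' with
  | mem_mul_mem y hy z hz =>
    obtain ⟨γ, rfl⟩ := hz
    exact (hr γ y).symm ▸ Submodule.smul_mem _ _ (hleft y hy)
  | add y _ z _ hy hz => simpa only [map_add] using add_mem hy hz

variable {m n : Ideal Γ} {q : Ideal B}

theorem map_mem_pow_smul_of_mem_level (hl : ∀ γ x, π (i γ * x) = l γ • π x)
    (hr : ∀ γ x, π (x * i γ) = r γ • π x) (hn : n ≤ q.comap l) (hm : m ≤ q.comap r)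
    {V : Submodule k U} {N : Submodule B E} (hVN : ∀ v ∈ V, π v ∈ N) {a : ℕ} {v : V}
    (hv : v ∈ level i m n V (a, a)) : π v ∈ q ^ a • N := by
  have hpow {I : Ideal Γ} {f : Γ →+* B} (hI : I ≤ q.comap f) : I ^ a ≤ (q ^ a).comap f :=
    (Ideal.pow_right_mono hI a).trans (Ideal.le_comap_pow f a)
  have hleft : ∀ x ∈ idealImage i (n ^ a) * V, π x ∈ q ^ a • N := by
    intro x hx
    induction hx using Submodule.mul_induction_on' with
    | mem_mul_mem c hc w hw =>
      obtain ⟨γ, hγ, rfl⟩ := hc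
      exact (hl γ w).symm ▸ Submodule.smul_mem_smul (hpow hn hγ) (hVN w hw)
    | add x _ y _ hx hy => simpa only [map_add] using add_mem hx hy
  have hright : ∀ x ∈ V * idealImage i (m ^ a), π x ∈ q ^ a • N := by
    intro x hx
    induction hx using Submodule.mul_induction_on' with
    | mem_mul_mem w hw c hc =>
      obtain ⟨γ, hγ, rfl⟩ := hc
      exact (hr γ w).symm ▸ Submodule.smul_mem_smul (hpow hm hγ) (hVN w hw)
    | add x _ y _ hx hy => simpa only [map_add] using add_mem hx hy
  obtain ⟨x, hx, y, hy, hxy : x + y = v⟩ := Submodule.mem_sup.1 hv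
  rw [← hxy, map_add]
  exact add_mem (hleft x hx) (hright y hy)

theorem map_eq_zero_of_toHom_eq_zero [IsDomain B] [IsNoetherianRing B] [Module.IsTorsionFree B E]
    (hl : ∀ γ x, π (i γ * x) = l γ • π x) (hr : ∀ γ x, π (x * i γ) = r γ • π x)
    (hq : q ≠ ⊤) (hn : n ≤ q.comap l) (hm : m ≤ q.comap r) {u : U} (hu : toHom i m n u = 0) :
    π u = 0 := by
  obtain ⟨⟨_, T, rfl⟩, _, hlevel⟩ := toHom_eq_zero_iff.1 hu
  have hfg : (Submodule.span B (π '' T)).FG := Submodule.fg_span (T.finite_toSet.image π)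
  rw [← Submodule.mem_bot B, ← iInf_pow_smul_eq_bot_of_fg hq hfg, Submodule.mem_iInf]
  exact fun a => map_mem_pow_smul_of_mem_level hl hr hn hm
    (fun _ => map_mem_span_of_mem_bimoduleSpan hl hr) (hlevel (a, a))

end BimoduleMap

section Coefficients

variable {k L : Type*} [Field k] [Field L] [Algebra k L] {M : Submonoid (L ≃ₐ[k] L)}
  {R : Type*} [CommRing R] [Algebra R L]

/-- The coefficient at `σ`, as a map linear over any ring `R` that acts on `L * M` through `L` from
the left. It is used over `Γ`, for finiteness, and over `K`, `L` and `k`. -/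
noncomputable def coeffAt (R : Type*) [CommRing R] [Algebra R L] (σ : M) : Skew M →ₗ[R] L :=
  (Finsupp.lapply σ).comp (SkewMonoidAlgebra.coeffLinearEquiv (S := R)).toLinearMap

theorem coeffAt_apply (σ : M) (x : Skew M) : coeffAt R σ x = x.coeff σ := rfl

variable [Algebra k R] [IsScalarTower k R L]

theorem coeff_baseHom_mul (r : R) (x : Skew M) (σ : M) :
    (baseHom R M r * x).coeff σ = algebraMap R L r * x.coeff σ :=
  SkewMonoidAlgebra.coeff_single_one_mul _ _ _

theorem coeff_mul_baseHom (r : R) (x : Skew M) (σ : M) :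
    (x * baseHom R M r).coeff σ = x.coeff σ * (σ : L ≃ₐ[k] L) (algebraMap R L r) :=
  SkewMonoidAlgebra.coeff_mul_single_one _ _ _

theorem baseHom_mul_eq_smul (r : R) (x : Skew M) : baseHom R M r * x = r • x := by
  ext σ
  rw [coeff_baseHom_mul, SkewMonoidAlgebra.coeff_smul, Finsupp.smul_apply, Algebra.smul_def]

theorem baseHom_algebraMap {R' : Type*} [CommRing R'] [Algebra k R'] [Algebra R' L]
    [IsScalarTower k R' L] [Algebra R R'] [IsScalarTower R R' L] (r : R) :
    baseHom R' M (algebraMap R R' r) = baseHom R M r :=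
  congrArg (SkewMonoidAlgebra.single 1) (IsScalarTower.algebraMap_apply R R' L r).symm

theorem toSubmodule_range_baseHom_mul_span (T : Set (Skew M)) :
    Subalgebra.toSubmodule (baseHom R M).range * Submodule.span k T =
      (Submodule.span R T).restrictScalars k := by
  apply le_antisymm
  · rw [Submodule.mul_le]
    rintro _ ⟨r, rfl⟩ x hx
    exact (baseHom_mul_eq_smul r x).symm ▸
      Submodule.smul_mem _ r (Submodule.span_le_restrictScalars k R T hx)
  · intro x hx
    induction hx using Submodule.span_induction with
    | mem t ht =>
      rw [← one_mul t]
      exact Submodule.mul_mem_mul (one_mem (baseHom R M).range) (Submodule.subset_span ht)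
    | zero => exact zero_mem _
    | add x y _ _ hx hy => exact add_mem hx hy
    | smul r x _ hx =>
      rw [← baseHom_mul_eq_smul, ← (Subalgebra.isIdempotentElem_toSubmodule _).eq, mul_assoc]
      exact Submodule.mul_mem_mul ⟨r, rfl⟩ hx

theorem isFGLeft_restrictScalars_iff {N : Submodule R (Skew M)} :
    IsFGLeft (baseHom R M).range (N.restrictScalars k) ↔ N.FG := by
  simp only [IsFGLeft, toSubmodule_range_baseHom_mul_span, Submodule.FG,
    Submodule.restrictScalars_inj, eq_comm]

end Coefficients

section Supported

variable {k L : Type*} [Field k] [Field L] [Algebra k L] {M : Submonoid (L ≃ₐ[k] L)}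
  {R : Type*} [CommRing R] [Algebra k R] [Algebra R L] [IsScalarTower k R L]
  {A : Subalgebra k (Skew M)}

/-- The elements with support in `S` of a subring `A` of `L * M` containing the image of `R`, as a
left `R`-module. It serves for the pair `Γ`, `U` as well as for `K` and the ring of invariants. -/
def supportedSubmodule (hA : ∀ r, baseHom R M r ∈ A) (S : Set M) : Submodule R (Skew M) where
  carrier := {x | x ∈ A ∧ ∀ τ ∉ S, x.coeff τ = 0}
  add_mem' hx hy := ⟨add_mem hx.1 hy.1, fun τ hτ => by
    rw [SkewMonoidAlgebra.coeff_add, Finsupp.add_apply, hx.2 τ hτ, hy.2 τ hτ, add_zero]⟩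
  zero_mem' := ⟨zero_mem A, fun _ _ => rfl⟩
  smul_mem' r x hx := by
    rw [← baseHom_mul_eq_smul]
    exact ⟨mul_mem (hA r) hx.1, fun τ hτ => by rw [coeff_baseHom_mul, hx.2 τ hτ, mul_zero]⟩

theorem fg_supportedSubmodule [IsNoetherian R L] (hA : ∀ r, baseHom R M r ∈ A) {S : Set M}
    (hS : S.Finite) : (supportedSubmodule hA S).FG := by
  have := hS.to_subtype
  let coeffs : supportedSubmodule hA S →ₗ[R] S → L :=
    (LinearMap.pi fun σ : S => coeffAt R σ.1).comp (supportedSubmodule hA S).subtype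
  have coeffs_injective : Function.Injective coeffs := by
    rintro ⟨x, hx⟩ ⟨y, hy⟩ hxy
    refine Subtype.ext (SkewMonoidAlgebra.ext fun σ => ?_)
    by_cases hσ : σ ∈ S
    · exact congrFun hxy ⟨σ, hσ⟩
    · rw [hx.2 σ hσ, hy.2 σ hσ]
  have := isNoetherian_of_injective coeffs coeffs_injective
  exact Module.Finite.iff_fg.1 inferInstance

variable {K Γ : Type*} [Field K] [Algebra k K] [Algebra K L] [IsScalarTower k K L]
  [CommRing Γ] [Algebra k Γ] [Algebra Γ L] [IsScalarTower k Γ L]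
  {hM : IsConjStable K M} {U : Subalgebra k (Skew M)}

theorem IsGaloisRing.baseHom_mem_invariants (hU : IsGaloisRing Γ hM U) (c : K) :
    baseHom K M c ∈ invariants hM := by
  rw [← Subalgebra.mem_toSubmodule, ← hU.left_span, ← mul_one (baseHom K M c)]
  exact Submodule.mul_mem_mul ⟨c, rfl⟩ (one_mem U)

theorem IsGaloisOrder.fg_supportedSubmodule [FiniteDimensional K L] (hU : IsGaloisOrder Γ hM U)
    {S : Set M} (hS : S.Finite) : (supportedSubmodule hU.base_le S).FG := by
  let W := (supportedSubmodule hU.baseHom_mem_invariants S).restrictScalars k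
  have hW : IsFGLeft (baseHom K M).range W :=
    isFGLeft_restrictScalars_iff.2 (GaloisOrder.fg_supportedSubmodule _ hS)
  have hWU : W ⊓ Subalgebra.toSubmodule U =
      (supportedSubmodule hU.base_le S).restrictScalars k := by
    ext x
    exact ⟨fun ⟨hxW, hxU⟩ => ⟨hxU, hxW.2⟩, fun ⟨hxU, hxS⟩ => ⟨⟨hU.le_invariants hxU, hxS⟩, hxU⟩⟩
  rw [← isFGLeft_restrictScalars_iff (k := k), ← hWU]
  exact hU.left_order W (fun _ hx => hx.1) hW

theorem IsGaloisOrder.exists_isNoetherian_subalgebra [IsNoetherianRing Γ] [FiniteDimensional K L]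
    (hU : IsGaloisOrder Γ hM U) {u : Skew M} (hu : u ∈ U) {σ : M} (hσ : u.coeff σ ≠ 0) :
    ∃ B : Subalgebra Γ L, IsNoetherian Γ B ∧
      ∀ γ : Γ, (σ : L ≃ₐ[k] L) (algebraMap Γ L γ) ∈ B := by
  let N := supportedSubmodule hU.base_le (u.support : Set M)
  let P := N.map (coeffAt Γ σ)
  have hP : P.FG := (hU.fg_supportedSubmodule (Finset.finite_toSet _)).map _
  have huN : u ∈ N := ⟨hu, fun τ hτ => by simpa using hτ⟩
  have hP₀ : P ≠ ⊥ := P.ne_bot_iff.2 ⟨u.coeff σ, ⟨u, huN, rfl⟩, hσ⟩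
  refine ⟨multiplierRing P, isNoetherian_multiplierRing hP hP₀, fun γ => ?_⟩
  rw [mem_multiplierRing]
  rintro _ ⟨x, hx, rfl⟩
  have hxγ : x * baseHom Γ M γ ∈ N := ⟨mul_mem hx.1 (hU.base_le γ), fun τ hτ => by
    rw [coeff_mul_baseHom, hx.2 τ hτ, zero_mul]⟩
  exact ⟨_, hxγ, (coeff_mul_baseHom γ x σ).trans (mul_comm _ _)⟩

end Supported

section Connecting

variable {k Γ K L : Type*} [Field k] [CommRing Γ] [Field K] [Algebra k K]
  [Field L] [Algebra K L] [Algebra k L] [Algebra Γ L] [IsScalarTower k K L]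

theorem translate_mul (σ τ : L ≃ₐ[k] L) (l : Ideal (integralClosure Γ L)) :
    translate (σ * τ) l = σ '' translate τ l :=
  (Set.image_image σ (fun x : integralClosure Γ L => τ x) l).symm

theorem conjHom_mem_connecting {M : Submonoid (L ≃ₐ[k] L)} {hM : IsConjStable K M}
    {lm ln : Ideal (integralClosure Γ L)} (g : L ≃ₐ[K] L) {σ : M}
    (hσ : σ ∈ connecting K M lm ln) : conjHom hM g σ ∈ connecting K M lm ln := by
  obtain ⟨g₁, g₂, h⟩ := hσ
  refine ⟨g * g₁, g * g₂, ?_⟩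
  have hconj : (conjHom hM g σ : L ≃ₐ[k] L) * galAut k (g * g₁) =
      galAut k g * (σ * galAut k g₁) := by
    simp [conjHom, mul_assoc]
  rw [hconj, map_mul, translate_mul, translate_mul _ (_ * _), h]

variable [Algebra Γ K] [IsScalarTower Γ K L]

theorem apply_algebraMap_mem_translate (σ : L ≃ₐ[k] L) (g : L ≃ₐ[K] L)
    {l : Ideal (integralClosure Γ L)} {γ : Γ} (hγ : algebraMap Γ (integralClosure Γ L) γ ∈ l) :
    σ (algebraMap Γ L γ) ∈ translate (σ * galAut k g) l :=
  ⟨_, hγ, congrArg σ ((g : L →ₐ[K] L).restrictScalars Γ |>.commutes γ)⟩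

theorem exists_ideal_mem_iff_mem_translate (B : Subalgebra Γ L) [Algebra.IsIntegral Γ B]
    (g : L ≃ₐ[K] L) {l : Ideal (integralClosure Γ L)} (hl : l ≠ ⊤) :
    ∃ q : Ideal B, q ≠ ⊤ ∧ ∀ b : B, b ∈ q ↔ (b : L) ∈ translate (galAut k g) l := by
  let φ : B →ₐ[Γ] L := (((g⁻¹ : L ≃ₐ[K] L) : L →ₐ[K] L).restrictScalars Γ).comp B.val
  let ψ : B →ₐ[Γ] integralClosure Γ L :=
    φ.codRestrict _ fun b => (Algebra.IsIntegral.isIntegral (R := Γ) b).map φ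
  refine ⟨l.comap ψ, Ideal.comap_ne_top ψ hl, fun b => ⟨fun hb => ?_, ?_⟩⟩
  · exact ⟨ψ b, hb, g.apply_symm_apply b⟩
  · rintro ⟨x, hx, hxb⟩
    have hψ : ψ b = x := Subtype.ext (g.symm_apply_eq.2 hxb.symm)
    rwa [Ideal.mem_comap, hψ]

end Connecting

section Injectivity

variable {k Γ K L : Type*} [Field k] [CommRing Γ] [IsNoetherianRing Γ] [Algebra k Γ]
  [Field K] [Algebra k K] [Algebra Γ K] [Field L] [Algebra K L] [Algebra k L] [Algebra Γ L]
  [IsScalarTower k K L] [IsScalarTower Γ K L] [IsScalarTower k Γ L] [FiniteDimensional K L]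
  {M : Submonoid (L ≃ₐ[k] L)} {hM : IsConjStable K M} {U : Subalgebra k (Skew M)}
  {m n : Ideal Γ} {lm ln : Ideal (integralClosure Γ L)}

theorem IsGaloisOrder.coeff_eq_zero_of_toHom_eq_zero (hU : IsGaloisOrder Γ hM U)
    (hlm : LiesAbove lm m) (hln : LiesAbove ln n) {σ : M} (hσ : σ ∈ connecting K M lm ln) {u : U}
    (hu : toHom hU.incl m n u = 0) : (u : Skew M).coeff σ = 0 := by
  by_contra hne
  obtain ⟨B, hB, hσB⟩ := hU.exists_isNoetherian_subalgebra u.2 hne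
  have : IsNoetherianRing B := isNoetherian_of_tower Γ hB
  obtain ⟨g₁, g₂, hg⟩ := hσ
  obtain ⟨q, hq, mem_q⟩ := exists_ideal_mem_iff_mem_translate (k := k) B g₂ hln.1.ne_top
  let s : Γ →+* B :=
    (((σ : L ≃ₐ[k] L) : L →+* L).comp (algebraMap Γ L)).codRestrict B hσB
  have hn : n ≤ q.comap (algebraMap Γ B) := fun γ hγ => by
    rw [← hln.2] at hγ
    simpa [mem_q] using apply_algebraMap_mem_translate 1 g₂ hγ
  have hm : m ≤ q.comap s := fun γ hγ => by
    rw [← hlm.2] at hγ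
    rw [Ideal.mem_comap, mem_q, hg]
    exact apply_algebraMap_mem_translate _ g₁ hγ
  let π : U →+ L := (coeffAt k σ).toAddMonoidHom.comp U.val.toAddMonoidHom
  have hl (γ : Γ) (x : U) : π (hU.incl γ * x) = algebraMap Γ B γ • π x :=
    coeff_baseHom_mul γ (x : Skew M) σ
  have hr (γ : Γ) (x : U) : π (x * hU.incl γ) = s γ • π x :=
    (coeff_mul_baseHom γ (x : Skew M) σ).trans (mul_comm _ _)
  have hπ : π u = 0 := map_eq_zero_of_toHom_eq_zero hl hr hq hn hm hu
  exact hne hπ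

theorem IsGaloisOrder.disjoint_supportedIn_ker_toHom (hU : IsGaloisOrder Γ hM U)
    (hlm : LiesAbove lm m) (hln : LiesAbove ln n) :
    Disjoint (supportedIn U (connecting K M lm ln)) (LinearMap.ker (toHom hU.incl m n)) := by
  rw [Submodule.disjoint_def]
  intro u hu hker
  refine Subtype.ext (SkewMonoidAlgebra.ext fun σ => ?_)
  by_contra hne
  exact hne (hU.coeff_eq_zero_of_toHom_eq_zero hlm hln (hu σ hne) hker)

end Injectivity

section OrbitSum

variable {k K L : Type*} [Field k] [Field K] [Field L] [Algebra k K] [Algebra K L] [Algebra k L]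
  [IsScalarTower k K L] [Finite (L ≃ₐ[K] L)] {M : Submonoid (L ≃ₐ[k] L)}

/-- The sum of the conjugates of `σ` under the Galois group. Each conjugate is taken once, not
once for each group element, so that no coefficient vanishes in positive characteristic. -/
noncomputable def orbitSum (hM : IsConjStable K M) (σ : M) : Skew M :=
  ∑ τ ∈ (Set.finite_range fun g => conjHom hM g σ).toFinset, SkewMonoidAlgebra.single τ 1

theorem orbitSum_mem_invariants (hM : IsConjStable K M) (σ : M) :
    orbitSum hM σ ∈ invariants hM := by
  have conjHom_mul (g h : L ≃ₐ[K] L) (τ : M) :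
      conjHom hM (g * h) τ = conjHom hM g (conjHom hM h τ) := by
    ext; simp [conjHom]
  have conjHom_one (τ : M) : conjHom hM 1 τ = τ := by
    ext; simp [conjHom]
  simp only [invariants, Algebra.mem_iInf, AlgHom.mem_equalizer, AlgHom.coe_id, id_eq]
  intro g
  rw [orbitSum, map_sum]
  refine Finset.sum_nbij' (conjHom hM g) (conjHom hM g⁻¹) ?_ ?_ ?_ ?_ ?_
  · simp only [Set.Finite.mem_toFinset, Set.forall_mem_range, ← conjHom_mul]
    exact fun h => ⟨g * h, rfl⟩
  · simp only [Set.Finite.mem_toFinset, Set.forall_mem_range, ← conjHom_mul]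
    exact fun h => ⟨g⁻¹ * h, rfl⟩
  · exact fun τ _ => by rw [← conjHom_mul, inv_mul_cancel, conjHom_one]
  · exact fun τ _ => by rw [← conjHom_mul, mul_inv_cancel, conjHom_one]
  · exact fun τ _ => by rw [galAct_single, map_one]

open Classical in
theorem coeff_orbitSum (hM : IsConjStable K M) (σ τ : M) :
    (orbitSum hM σ).coeff τ = if ∃ g, conjHom hM g σ = τ then 1 else 0 := by
  rw [orbitSum, ← coeffAt_apply (R := L), map_sum]
  simp [coeffAt_apply, Finsupp.single_apply]

end OrbitSum

section Nonzero

variable {k Γ K L : Type*} [Field k] [CommRing Γ] [Algebra k Γ]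
  [Field K] [Algebra k K] [Algebra Γ K] [IsFractionRing Γ K]
  [Field L] [Algebra K L] [Algebra k L] [Algebra Γ L]
  [IsScalarTower k K L] [IsScalarTower Γ K L] [IsScalarTower k Γ L]
  {M : Submonoid (L ≃ₐ[k] L)} {hM : IsConjStable K M} {U : Subalgebra k (Skew M)}

theorem IsGaloisRing.exists_baseHom_mul_mem (hU : IsGaloisRing Γ hM U) {x : Skew M}
    (hx : x ∈ invariants hM) : ∃ γ ∈ nonZeroDivisors Γ, baseHom Γ M γ * x ∈ U := by
  rw [← Subalgebra.mem_toSubmodule, ← hU.left_span] at hx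
  induction hx using Submodule.mul_induction_on' with
  | mem_mul_mem c hc u hu =>
    obtain ⟨c, rfl⟩ := hc
    obtain ⟨⟨a, b⟩, hab⟩ := IsLocalization.surj (nonZeroDivisors Γ) c
    have hclear : baseHom Γ M b * baseHom K M c = baseHom Γ M a := by
      rw [← baseHom_algebraMap (R' := K) b.1, ← baseHom_algebraMap (R' := K) a, ← map_mul,
        mul_comm, hab]
    refine ⟨b, b.2, ?_⟩
    change baseHom Γ M b * (baseHom K M c * u) ∈ U
    rw [← mul_assoc, hclear]
    exact mul_mem (hU.base_le a) hu
  | add x _ y _ ihx ihy =>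
    obtain ⟨a, ha, hax⟩ := ihx
    obtain ⟨b, hb, hby⟩ := ihy
    have hsplit : baseHom Γ M (a * b) * (x + y) =
        baseHom Γ M b * (baseHom Γ M a * x) + baseHom Γ M a * (baseHom Γ M b * y) := by
      simp only [baseHom_mul_eq_smul, smul_smul, smul_add, mul_comm b a]
    exact ⟨a * b, mul_mem ha hb,
      hsplit ▸ add_mem (mul_mem (hU.base_le b) hax) (mul_mem (hU.base_le a) hby)⟩

theorem IsGaloisRing.supportedIn_ne_bot [Finite (L ≃ₐ[K] L)] (hU : IsGaloisRing Γ hM U)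
    {S : Set M} (hS : ∀ g, ∀ σ ∈ S, conjHom hM g σ ∈ S) (hne : S.Nonempty) :
    supportedIn U S ≠ ⊥ := by
  classical
  obtain ⟨σ, hσ⟩ := hne
  obtain ⟨γ, hγ, hγU⟩ := hU.exists_baseHom_mul_mem (orbitSum_mem_invariants hM σ)
  have hcoeff (τ : M) : (baseHom Γ M γ * orbitSum hM σ).coeff τ =
      algebraMap Γ L γ * if ∃ g, conjHom hM g σ = τ then 1 else 0 := by
    rw [coeff_baseHom_mul, coeff_orbitSum]
  have hsupp : (⟨_, hγU⟩ : U) ∈ supportedIn U S := by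
    intro τ hτ
    obtain ⟨g, rfl⟩ : ∃ g, conjHom hM g σ = τ := by
      by_contra hτσ
      exact hτ (by rw [hcoeff, if_neg hτσ, mul_zero])
    exact hS g σ hσ
  have hγ₀ : algebraMap Γ L γ ≠ 0 := by
    rw [IsScalarTower.algebraMap_apply Γ K L, map_ne_zero]
    exact (IsLocalization.map_units K ⟨γ, hγ⟩).ne_zero
  have hσσ : ∃ g : L ≃ₐ[K] L, conjHom hM g σ = σ := ⟨1, by ext; simp [conjHom]⟩
  refine (Submodule.ne_bot_iff _).2 ⟨_, hsupp, fun hzero => hγ₀ ?_⟩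
  have hzero' : (baseHom Γ M γ * orbitSum hM σ).coeff σ = 0 := by
    rw [show baseHom Γ M γ * orbitSum hM σ = 0 from congrArg Subtype.val hzero]
    rfl
  rwa [hcoeff, if_pos hσσ, mul_one] at hzero'

end Nonzero

end GaloisOrder

theorem mainTheorem10_general
    {k Γ K L : Type*} [Field k] [CommRing Γ] [IsNoetherianRing Γ] [Algebra k Γ]
    [Field K] [Algebra k K] [Algebra Γ K] [IsFractionRing Γ K]
    [Field L] [Algebra K L] [Algebra k L] [Algebra Γ L]
    [IsScalarTower k K L] [IsScalarTower Γ K L] [IsScalarTower k Γ L] [FiniteDimensional K L]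
    {M : Submonoid (L ≃ₐ[k] L)} {hM : GaloisOrder.IsConjStable K M}
    {U : Subalgebra k (GaloisOrder.Skew M)} (hU : GaloisOrder.IsGaloisOrder Γ hM U)
    {m n : Ideal Γ} {lm ln : Ideal (integralClosure Γ L)}
    (hlm : GaloisOrder.LiesAbove lm m) (hln : GaloisOrder.LiesAbove ln n)
    (hne : (GaloisOrder.connecting K M lm ln).Nonempty) :
    (GaloisOrder.supportedIn U (GaloisOrder.connecting K M lm ln)).map
      (GaloisOrder.toHom hU.toIsGaloisRing.incl m n) ≠ ⊥ := by
  intro hmap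
  have hinj := hU.disjoint_supportedIn_ker_toHom hlm hln
  have hnonzero := hU.supportedIn_ne_bot (fun g _ => GaloisOrder.conjHom_mem_connecting g) hne
  exact hnonzero (hinj.eq_bot_of_le (LinearMap.le_ker_iff_map.2 hmap))

theorem mainTheorem10
    {k Γ K L : Type*} [Field k] [IsAlgClosed k] [CharZero k]
    [CommRing Γ] [IsDomain Γ] [IsNoetherianRing Γ] [Algebra k Γ]
    [Field K] [Algebra k K] [Algebra Γ K] [IsScalarTower k Γ K] [IsFractionRing Γ K]
    [Field L] [Algebra K L] [Algebra k L] [Algebra Γ L]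
    [IsScalarTower k K L] [IsScalarTower Γ K L] [IsScalarTower k Γ L]
    [FiniteDimensional K L] [IsGalois K L]
    (M : Submonoid (L ≃ₐ[k] L)) (hM : GaloisOrder.IsConjStable K M)
    (hsep : GaloisOrder.IsSeparating K M)
    (U : Subalgebra k (GaloisOrder.Skew M)) (hU : GaloisOrder.IsGaloisOrder Γ hM U)
    (m n : Ideal Γ) (hm : m.IsMaximal) (hn : n.IsMaximal)
    (lm ln : Ideal (integralClosure Γ L))
    (hlm : GaloisOrder.LiesAbove lm m) (hln : GaloisOrder.LiesAbove ln n)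
    (hfin : (GaloisOrder.connecting K M lm ln).Finite)
    (hfin_m : (GaloisOrder.stabilizer M lm).Finite)
    (hfin_n : (GaloisOrder.stabilizer M ln).Finite)
    (hne : (GaloisOrder.connecting K M lm ln).Nonempty) :
    (GaloisOrder.supportedIn U (GaloisOrder.connecting K M lm ln)).map
      (GaloisOrder.toHom hU.toIsGaloisRing.incl m n) ≠ ⊥ :=
  mainTheorem10_general hU hlm hln hne
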